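/- Let $G$ be the complete graph on $n$ vertices, with vertex set $V$ and edge set $E$, and let $X=(X_e)_{e\in E}$ be independent random variables with $|X_e|\le 1$ almost surely, each having a density with respect to Lebesgue measure bounded above by $\phi$. For $\sigma\in\{-1,1\}^V$ put $H(\sigma)=-\frac12\sum_{uv\in E}X_{uv}\,\sigma(u)\sigma(v)$; this differs from the weight of the cut given by $\sigma$ by a quantity that does not depend on $\sigma$. An improving move from $\sigma$ is a configuration $\sigma'$ that differs from $\sigma$ at exactly one vertex and has $H(\sigma')>H(\sigma)$; a local max-cut is a configuration that has no improving move; an improving sequence is a sequence of consecutive improving moves, and its length is the number of moves. An implementation of FLIP is a rule that chooses an initial configuration and then, as long as the current configuration is not a local max-cut, an improving move from it, where the choices may depend on all the weights and on all configurations visited so far. Let $\eta>0$. (1) There is a constant $C>0$ depending only on $\eta$ such that, with probability at least $1-o(1)$ as $n\to\infty$, every implementation of FLIP (simultaneously) reaches a local max-cut after at most $C\phi^5n^{15+\eta}$ steps. Here $o(1)$ depends only on $n$ and $\eta$. (2) Equivalently, an improving sequence of length $\Omega(\phi^5n^{15+\eta})$ exists only with probability $o(1)$: for every constant $c>0$,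 the probability that there is an improving sequence of length at least $c\,\phi^5n^{15+\eta}$, from any initial configuration, tends to $0$ as $n\to\infty$, at a rate that depends only on $c$ and $\eta$. -/

import Mathlib

open MeasureTheory ProbabilityTheory Filter Topology

noncomputable section

namespace LocalMaxCut

/-- Spin configurations `σ : V → {-1, 1}`; the group `ℤˣ` is `{1, -1}`. -/
abbrev Config (V : Type*) := V → ℤˣ

/-- The product `σ(u) σ(v)` of the spins at the two ends of the pair `s(u, v)`. -/
def spinProd {V : Type*} (σ : Config V) : Sym2 V → ℝ :=
  Sym2.lift ⟨fun u v => ((σ u : ℤ) : ℝ) * ((σ v : ℤ) : ℝ), fun _ _ => mul_comm _ _⟩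

section Flip

variable {V : Type*} [Fintype V] {G : SimpleGraph V} [Fintype G.edgeSet]

/-- The Hamiltonian `H(σ) = -(1/2) ∑_{uv ∈ E} w(uv) σ(u) σ(v)`. It differs from the weight of the
cut given by `σ` by half of the total edge weight, which does not depend on `σ`. -/
def hamiltonian (w : G.edgeSet → ℝ) (σ : Config V) : ℝ :=
  -(1 / 2) * ∑ e : G.edgeSet, w e * spinProd σ (e : Sym2 V)

/-- `σ'` is an improving move from `σ`: the two differ at exactly one vertex and `H` increases. -/
def IsImprovingMove (w : G.edgeSet → ℝ) (σ σ' : Config V) : Prop :=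
  hammingDist σ' σ = 1 ∧ hamiltonian w σ < hamiltonian w σ'

/-- `σ` is a local maximum of `H` with respect to the Hamming distance, that is, a local
max-cut. -/
def IsLocalMaxCut (w : G.edgeSet → ℝ) (σ : Config V) : Prop :=
  ∀ σ' : Config V, hammingDist σ' σ = 1 → hamiltonian w σ' ≤ hamiltonian w σ

/-- `σ 0, σ 1, …, σ ℓ` is a sequence of `ℓ` improving moves. -/
def IsImprovingSeq (w : G.edgeSet → ℝ) (ℓ : ℕ) (σ : ℕ → Config V) : Prop :=
  ∀ t < ℓ, IsImprovingMove w (σ t) (σ (t + 1))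

variable (G) in
/-- An implementation of FLIP: a choice of the initial configuration, and a choice of an improving
move whenever there is one. Both choices may depend on all the edge weights, and the second one
also on the list of all configurations visited earlier (most recent first). -/
structure Implementation where
  /-- the initial configuration -/
  init : (G.edgeSet → ℝ) → Config V
  /-- the next configuration, given the weights, the past and the current configuration -/
  next : (G.edgeSet → ℝ) → List (Config V) → Config V → Config V
  improving : ∀ (w : G.edgeSet → ℝ) (past : List (Config V)) (σ : Config V),
    ¬ IsLocalMaxCut w σ → IsImprovingMove w σ (next w past σ)

open Classical in
/-- The past and the current configuration after `t` steps; the run stays put once the current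
configuration is a local maximum. -/
def Implementation.run (I : Implementation G) (w : G.edgeSet → ℝ) :
    ℕ → List (Config V) × Config V
  | 0 => ([], I.init w)
  | t + 1 =>
    let p := I.run w t
    if IsLocalMaxCut w p.2 then p else (p.2 :: p.1, I.next w p.1 p.2)

/-- On the weights `w`, the implementation reaches a local max-cut after at most `T` steps. -/
def Implementation.TerminatesWithin (I : Implementation G) (w : G.edgeSet → ℝ) (T : ℝ) : Prop :=
  ∃ t : ℕ, (t : ℝ) ≤ T ∧ IsLocalMaxCut w (I.run w t).2

end Flip

/-- Independent random edge weights with values in `[-1, 1]`, each having a density with respect to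
Lebesgue measure that is bounded by `φ`. -/
structure IsSmoothedWeights {V : Type*} {G : SimpleGraph V} {Ω : Type*} [MeasurableSpace Ω]
    (P : Measure Ω) (X : G.edgeSet → Ω → ℝ) (φ : ℝ) : Prop where
  indep : iIndepFun X P
  abs_le_one : ∀ e, ∀ᵐ ω ∂P, |X e ω| ≤ 1
  hasPDF : ∀ e, HasPDF (X e) P volume
  pdf_le : ∀ e, ∀ᵐ x ∂(volume : Measure ℝ), pdf (X e) P volume x ≤ ENNReal.ofReal φ

end LocalMaxCut

end

noncomputable section

namespace LocalMaxCut

open scoped ENNReal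

/-! Since `|H| ≤ n² / 4`, a long improving sequence contains `2n` consecutive moves with total gain
at most a small `ε`, so each of these moves gains at most `ε`. A single gain involves the spins of
all vertices, too many for a union bound. Adding the gains of two successive moves of one vertex
cancels every edge to a vertex that moved an even number of times in between; the resulting form
depends only on the spins of moving vertices (`pairForm_congr`). Among the `2n` moves there is a
critical block of `2s` moves of `s` vertices (`exists_critical_subword`). It yields at least `s / 4`
such forms, triangular with pivot coefficients of modulus at least `1`
(`IsCriticalWord.exists_triangular`), so all its forms lie in `[0, 2ε]` with probability at most
`(2φε)^(s/4)` when `2φε ≤ 1` (`pi_triangular_le`). There are `(2n)^(2s)` codes for a word with its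
starting spins, so the sum over `s` is small once `2φε` is of order `n⁻¹²`; with `ε` of order `n³ /
T`, this is what `T = c φ⁵ n^(15+η)` ensures. -/

/-! ### Small ball estimates for triangular families of linear forms -/

/-- Integrating out one coordinate first does not change an integral over a product. -/
theorem lintegral_pi_eq_lintegral_update {E : Type*} [Fintype E] [DecidableEq E]
    (μ : E → Measure ℝ) [∀ e, IsProbabilityMeasure (μ e)] (f : (E → ℝ) → ℝ≥0∞)
    (hf : Measurable f) (e : E) :
    ∫⁻ x, f x ∂(Measure.pi μ) =
      ∫⁻ x, (∫⁻ y, f (Function.update x e y) ∂(μ e)) ∂(Measure.pi μ) := by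
  have hg : Measurable fun x : E → ℝ => ∫⁻ y, f (Function.update x e y) ∂(μ e) := by
    apply Measurable.lintegral_prod_right'
      (f := fun p : (E → ℝ) × ℝ => f (Function.update p.1 e p.2))
    exact hf.comp measurable_update'
  have x₀ : E → ℝ := 0
  rw [lintegral_eq_lmarginal_univ x₀, lintegral_eq_lmarginal_univ x₀,
    lmarginal_erase' f hf (Finset.mem_univ e), lmarginal_erase' _ hg (Finset.mem_univ e)]
  simp

/-- With the other coordinates fixed, membership in `A` is already decided, and the coordinate `e`
alone costs a factor `K`. -/
theorem pi_inter_le_mul {E : Type*} [Fintype E] [DecidableEq E]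
    (μ : E → Measure ℝ) [∀ e, IsProbabilityMeasure (μ e)] (K : ℝ≥0∞) (e : E)
    (A B : Set (E → ℝ)) (hA : MeasurableSet A) (hB : MeasurableSet B)
    (hAe : ∀ x y, Function.update x e y ∈ A ↔ x ∈ A)
    (hBe : ∀ x, μ e {y | Function.update x e y ∈ B} ≤ K) :
    Measure.pi μ (B ∩ A) ≤ K * Measure.pi μ A := by
  rw [← lintegral_indicator_one (hB.inter hA),
    lintegral_pi_eq_lintegral_update μ _ (measurable_one.indicator (hB.inter hA)) e,
    ← lintegral_indicator_one hA, ← lintegral_const_mul _ (measurable_one.indicator hA)]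
  refine lintegral_mono fun x => ?_
  by_cases hx : x ∈ A
  · have hm : MeasurableSet {y | Function.update x e y ∈ B} := (measurable_update x) hB
    have : ∀ y, (B ∩ A).indicator (1 : (E → ℝ) → ℝ≥0∞) (Function.update x e y) =
        {y | Function.update x e y ∈ B}.indicator 1 y := by
      intro y
      by_cases hy : Function.update x e y ∈ B <;> simp [hy, hAe, hx]
    simp only [this, lintegral_indicator_one hm]
    simpa [hx] using hBe x
  · have : ∀ y, (B ∩ A).indicator (1 : (E → ℝ) → ℝ≥0∞) (Function.update x e y) = 0 := by
      intro y
      simp [hAe, hx]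
    simp [this]

/-- A family of linear forms that is triangular with respect to some pivot coordinates is unlikely
to be simultaneously small. -/
theorem pi_triangular_le {ι E : Type*} [Fintype E] [DecidableEq E] [DecidableEq ι]
    (μ : E → Measure ℝ) [∀ e, IsProbabilityMeasure (μ e)] (K : ℝ≥0∞) (L : ℝ)
    (hμ : ∀ e, ∀ a b : ℝ, 1 ≤ |b| → μ e {x | a + b * x ∈ Set.Icc 0 L} ≤ K)
    (β : ι → E → ℝ) (p : ι → E) (ord : ι → ℕ) (I : Finset ι)
    (h1 : ∀ i ∈ I, 1 ≤ |β i (p i)|)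
    (h2 : ∀ i ∈ I, ∀ j ∈ I, i ≠ j → ord j ≤ ord i → β j (p i) = 0) :
    Measure.pi μ {x | ∀ i ∈ I, ∑ e, β i e * x e ∈ Set.Icc 0 L} ≤ K ^ I.card := by
  -- Peel off a form of maximal `ord`: no remaining form involves its pivot, so that coordinate can
  -- be integrated first.
  induction I using Finset.induction_on_max_value ord with
  | empty => simp
  | insert i s hi hmax ih =>
    have hmeas : ∀ j, MeasurableSet {x : E → ℝ | ∑ e, β j e * x e ∈ Set.Icc 0 L} := by
      intro j
      have : Measurable fun x : E → ℝ => ∑ e, β j e * x e := by fun_prop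
      exact this measurableSet_Icc
    have hupd : ∀ j x y, ∑ e, β j e * Function.update x (p i) y e =
        (∑ e ∈ Finset.univ.erase (p i), β j e * x e) + β j (p i) * y := by
      intro j x y
      rw [← Finset.sum_erase_add _ _ (Finset.mem_univ (p i))]
      congr 1
      · refine Finset.sum_congr rfl fun e he => ?_
        rw [Function.update_of_ne (Finset.ne_of_mem_erase he)]
      · simp
    have hset : {x : E → ℝ | ∀ k ∈ insert i s, ∑ e, β k e * x e ∈ Set.Icc 0 L} =
        {x | ∑ e, β i e * x e ∈ Set.Icc 0 L} ∩
        {x | ∀ k ∈ s, ∑ e, β k e * x e ∈ Set.Icc 0 L} := by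
      ext x
      simp only [Finset.forall_mem_insert, Set.mem_inter_iff, Set.mem_ofPred_eq]
    rw [hset, Finset.card_insert_of_notMem hi, pow_succ']
    refine (pi_inter_le_mul μ K (p i) _ _ ?_ (hmeas i) ?_ ?_).trans
      (mul_le_mul_right (ih (fun j hj => h1 j (Finset.mem_insert_of_mem hj))
        fun j hj k hk => h2 j (Finset.mem_insert_of_mem hj) k (Finset.mem_insert_of_mem hk)) K)
    · have : {x : E → ℝ | ∀ k ∈ s, ∑ e, β k e * x e ∈ Set.Icc 0 L} =
          ⋂ k ∈ s, {x | ∑ e, β k e * x e ∈ Set.Icc 0 L} := by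
        ext x
        simp only [Set.mem_ofPred_eq, Set.mem_iInter]
      rw [this]
      exact Finset.measurableSet_biInter _ fun k _ => hmeas k
    · intro x y
      simp only [Set.mem_ofPred_eq]
      refine forall₂_congr fun k hk => ?_
      have h0 : β k (p i) = 0 :=
        h2 i (Finset.mem_insert_self _ _) k (Finset.mem_insert_of_mem hk)
          (fun h => hi (h ▸ hk)) (hmax k hk)
      rw [hupd, h0, zero_mul, add_zero, ← Finset.sum_erase_add _ _ (Finset.mem_univ (p i)), h0,
        zero_mul, add_zero]
    · intro x
      simp only [Set.mem_ofPred_eq, hupd]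
      exact hμ _ _ _ (h1 i (Finset.mem_insert_self _ _))

/-! ### Small ball estimates for the edge weights. -/

section Weights

variable {V : Type*} {G : SimpleGraph V} {Ω : Type*} [MeasurableSpace Ω]
  {P : Measure Ω} {X : G.edgeSet → Ω → ℝ} {φ : ℝ}

theorem IsSmoothedWeights.map_le (hX : IsSmoothedWeights P X φ) (e : G.edgeSet) (s : Set ℝ) :
    P.map (X e) s ≤ ENNReal.ofReal φ * volume s := by
  have := hX.hasPDF e
  have hle : P.map (X e) ≤ ENNReal.ofReal φ • volume := by
    rw [map_eq_withDensity_pdf (X e) P volume, ← withDensity_const]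
    exact withDensity_mono (hX.pdf_le e)
  simpa using hle s

theorem IsSmoothedWeights.map_affine_le (hX : IsSmoothedWeights P X φ) (e : G.edgeSet)
    (a b L : ℝ) (hb : 1 ≤ |b|) :
    P.map (X e) {x | a + b * x ∈ Set.Icc 0 L} ≤ ENNReal.ofReal φ * ENNReal.ofReal L := by
  refine (hX.map_le e _).trans (mul_le_mul_right ?_ _)
  refine (Real.volume_le_diam _).trans (Metric.ediam_le fun x hx y hy => ?_)
  rw [edist_dist, Real.dist_eq]
  apply ENNReal.ofReal_le_ofReal
  simp only [Set.mem_ofPred_eq, Set.mem_Icc] at hx hy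
  calc |x - y| ≤ |b| * |x - y| := le_mul_of_one_le_left (abs_nonneg _) hb
    _ = |b * x - b * y| := by rw [← abs_mul, mul_sub]
    _ ≤ L := abs_le.2 ⟨by linarith, by linarith⟩

/-- Total mass `1` on an interval of length `2` forces `2φ ≥ 1`. -/
theorem IsSmoothedWeights.half_le [IsProbabilityMeasure P] (hX : IsSmoothedWeights P X φ)
    (e : G.edgeSet) : 1 / 2 ≤ φ := by
  have := hX.hasPDF e
  have hae : AEMeasurable (X e) P := HasPDF.aemeasurable (X e) P volume
  have h1 : P.map (X e) (Set.Icc (-1) 1) = 1 := by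
    rw [Measure.map_apply_of_aemeasurable hae measurableSet_Icc, ← measure_univ (μ := P)]
    apply measure_congr
    rw [eventuallyEq_univ]
    filter_upwards [hX.abs_le_one e] with ω hω
    exact abs_le.1 hω
  have h2 := hX.map_le e (Set.Icc (-1) 1)
  rw [h1, Real.volume_Icc, ← ENNReal.ofReal_mul' (by norm_num), ← ENNReal.ofReal_one] at h2
  have h3 : (1 : ℝ) ≤ φ * (1 - -1) := by
    by_contra hlt
    push Not at hlt
    exact absurd h2 (not_le.2 ((ENNReal.ofReal_lt_ofReal_iff one_pos).2 hlt))
  linarith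

theorem IsSmoothedWeights.triangular_le [Fintype G.edgeSet] [IsProbabilityMeasure P]
    (hX : IsSmoothedWeights P X φ) {ι : Type*} (L : ℝ)
    (β : ι → G.edgeSet → ℝ) (p : ι → G.edgeSet) (ord : ι → ℕ) (I : Finset ι)
    (h1 : ∀ i ∈ I, 1 ≤ |β i (p i)|)
    (h2 : ∀ i ∈ I, ∀ j ∈ I, i ≠ j → ord j ≤ ord i → β j (p i) = 0) :
    P {ω | ∀ i ∈ I, ∑ e, β i e * X e ω ∈ Set.Icc 0 L} ≤
      (ENNReal.ofReal φ * ENNReal.ofReal L) ^ I.card := by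
  classical
  have hae : ∀ e, AEMeasurable (X e) P := fun e => by
    have := hX.hasPDF e
    exact HasPDF.aemeasurable (X e) P volume
  have := fun e => Measure.isProbabilityMeasure_map (hae e)
  have hmap := (iIndepFun_iff_map_fun_eq_pi_map hae).1 hX.indep
  have key := pi_triangular_le (fun e => P.map (X e)) _ L
    (fun e a b hb => hX.map_affine_le e a b L hb) β p ord I h1 h2
  rw [← hmap] at key
  exact (Measure.le_map_apply (aemeasurable_pi_lambda _ hae) _).trans key

end Weights

/-! ### Combinatorics of words -/

section Words

variable {V : Type*}

/-- The positions `i < j` carry the same letter, which does not occur in between. -/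
structure Successive (w : ℕ → V) (i j : ℕ) : Prop where
  lt : i < j
  eq : w i = w j
  ne : ∀ k, i < k → k < j → w k ≠ w i

theorem Successive.fst_eq_of_overlap {w : ℕ → V} {i j i' j' q : ℕ} (h : Successive w i j)
    (h' : Successive w i' j') (hw : w i = w i') (hi : i < q) (hj : q < j) (hi' : i' < q)
    (hj' : q < j') : i = i' := by
  rcases lt_trichotomy i i' with hlt | rfl | hlt
  · exact absurd hw.symm (h.ne i' hlt (by omega))
  · rfl
  · exact absurd hw (h'.ne i hlt (by omega))

theorem Successive.snd_eq {w : ℕ → V} {i j j' : ℕ} (h : Successive w i j)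
    (h' : Successive w i j') : j = j' := by
  rcases lt_trichotomy j j' with hlt | rfl | hlt
  · exact absurd h.eq.symm (h'.ne j h.lt hlt)
  · rfl
  · exact absurd h'.eq.symm (h.ne j' h'.lt hlt)

theorem exists_successive {w : ℕ → V} {i k : ℕ} (hik : i < k) (hw : w k = w i) :
    ∃ j ≤ k, Successive w i j := by
  have hex : ∃ j, i < j ∧ w j = w i := ⟨k, hik, hw⟩
  classical
  refine ⟨Nat.find hex, Nat.find_min' hex ⟨hik, hw⟩, (Nat.find_spec hex).1,
    (Nat.find_spec hex).2.symm, fun m hm hmj hwm => Nat.find_min hex hmj ⟨hm, hwm⟩⟩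

variable [DecidableEq V]

/-- The number of occurrences of `u` in the word `w` at the positions in `[a, b)`. -/
def occ (w : ℕ → V) (a b : ℕ) (u : V) : ℕ := ((Finset.Ico a b).filter fun i => w i = u).card

/-- The prefix of `w` of length `2 s` has `s` distinct letters, every subword has length at most
twice its number of distinct letters, and between two successive occurrences of a letter some other
letter occurs an odd number of times. -/
structure IsCriticalWord (w : ℕ → V) (s : ℕ) : Prop where
  card_eq : ((Finset.Ico 0 (2 * s)).image w).card = s
  le_card : ∀ a b, b ≤ 2 * s → b - a ≤ 2 * ((Finset.Ico a b).image w).card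
  exists_odd : ∀ i j, j < 2 * s → Successive w i j → ∃ u ≠ w i, Odd (occ w i j u)

theorem occ_split (w : ℕ → V) {a b c : ℕ} (hab : a ≤ b) (hbc : b ≤ c) (u : V) :
    occ w a c u = occ w a b u + occ w b c u := by
  unfold occ
  rw [← Finset.Ico_union_Ico_eq_Ico hab hbc, Finset.filter_union, Finset.card_union_of_disjoint]
  exact Finset.disjoint_filter_filter (Finset.Ico_disjoint_Ico_consecutive a b c)

theorem occ_succ (w : ℕ → V) {a b : ℕ} (hab : a ≤ b) (u : V) :
    occ w a (b + 1) u = occ w a b u + if w b = u then 1 else 0 := by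
  rw [occ_split w hab (Nat.le_succ b)]
  simp [occ, Finset.filter_singleton, apply_ite]

theorem Successive.occ_eq_one {w : ℕ → V} {i j : ℕ} (h : Successive w i j) :
    occ w i j (w i) = 1 := by
  rw [occ, Finset.card_eq_one]
  refine ⟨i, Finset.ext fun k => ?_⟩
  simp only [Finset.mem_filter, Finset.mem_Ico, Finset.mem_singleton]
  constructor
  · rintro ⟨⟨h1, h2⟩, h3⟩
    by_contra hne
    exact h.ne k (by omega) h2 h3
  · rintro rfl
    exact ⟨⟨le_rfl, h.lt⟩, rfl⟩

/-- The positions of the letters that occur exactly once among the first `m`. -/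
def singles (w : ℕ → V) (m : ℕ) : Finset ℕ :=
  (Finset.range m).filter fun q => occ w 0 m (w q) = 1

/-- The letters that occur at least twice among the first `m`. -/
def repeated (w : ℕ → V) (m : ℕ) : Finset V :=
  ((Finset.Ico 0 m).image w).filter fun v => occ w 0 m v ≠ 1

theorem eq_of_mem_singles {w : ℕ → V} {m q k : ℕ} (hq : q ∈ singles w m) (hk : k < m)
    (h : w k = w q) : k = q := by
  obtain ⟨hqm, h1⟩ := Finset.mem_filter.1 hq
  obtain ⟨x, hx⟩ := Finset.card_eq_one.1 h1
  rw [Finset.mem_range] at hqm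
  have h1 : k ∈ ({x} : Finset ℕ) := by rw [← hx]; simp [hk, h]
  have h2 : q ∈ ({x} : Finset ℕ) := by rw [← hx]; simp [hqm]
  rw [Finset.mem_singleton] at h1 h2
  rw [h1, h2]

theorem mem_singles_or_repeated (w : ℕ → V) {m k : ℕ} (hk : k < m) :
    k ∈ singles w m ∨ w k ∈ repeated w m := by
  by_cases h : occ w 0 m (w k) = 1
  · left; simp [singles, hk, h]
  · right
    simp only [repeated, Finset.mem_filter, Finset.mem_image, Finset.mem_Ico]
    exact ⟨⟨k, by omega, rfl⟩, h⟩

theorem card_singles_add_card_repeated (w : ℕ → V) (m : ℕ) :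
    (singles w m).card + (repeated w m).card = ((Finset.Ico 0 m).image w).card := by
  have h1 : (singles w m).card =
      (((Finset.Ico 0 m).image w).filter fun v => occ w 0 m v = 1).card := by
    apply Finset.card_bij (fun q _ => w q)
    · intro q hq
      simp only [singles, Finset.mem_filter, Finset.mem_range, Finset.mem_image,
        Finset.mem_Ico] at hq ⊢
      exact ⟨⟨q, ⟨by omega, hq.1⟩, rfl⟩, hq.2⟩
    · intro q hq q' hq' h
      exact eq_of_mem_singles hq' (by simpa using (Finset.mem_filter.1 hq).1) h
    · intro v hv
      simp only [singles, Finset.mem_filter, Finset.mem_range, Finset.mem_image,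
        Finset.mem_Ico] at hv ⊢
      obtain ⟨⟨q, hq, rfl⟩, h⟩ := hv
      exact ⟨q, ⟨hq.2, h⟩, rfl⟩
  rw [h1, repeated]
  exact Finset.card_filter_add_card_filter_not _

theorem exists_successive_of_mem_repeated {w : ℕ → V} {m : ℕ} {v : V} (hv : v ∈ repeated w m) :
    ∃ i j, j < m ∧ w i = v ∧ Successive w i j := by
  simp only [repeated, Finset.mem_filter, Finset.mem_image, Finset.mem_Ico] at hv
  obtain ⟨⟨k, hk, rfl⟩, h⟩ := hv
  have hlt : 1 < occ w 0 m (w k) := by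
    have : 0 < occ w 0 m (w k) := Finset.card_pos.2 ⟨k, by simp [hk.2]⟩
    omega
  obtain ⟨a, ha, b, hb, hab⟩ := Finset.one_lt_card.1 hlt
  simp only [Finset.mem_filter, Finset.mem_Ico] at ha hb
  rcases lt_or_gt_of_ne hab with hab | hab
  · obtain ⟨j, hj, hs⟩ := exists_successive hab (hb.2.trans ha.2.symm)
    exact ⟨a, j, by omega, ha.2, hs⟩
  · obtain ⟨j, hj, hs⟩ := exists_successive hab (ha.2.trans hb.2.symm)
    exact ⟨b, j, by omega, hb.2, hs⟩

open Classical in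
/-- The pairs of successive positions that are separated by the position of a letter that occurs
only once. -/
def separatedPairs (w : ℕ → V) (m : ℕ) : Finset (ℕ × ℕ) :=
  (Finset.range m ×ˢ Finset.range m).filter fun k =>
    Successive w k.1 k.2 ∧ ∃ q ∈ singles w m, k.1 < q ∧ q < k.2

/-- Let `S` be the set of single positions, `R` that of repeated letters and `N` the remaining
positions. As `2s` positions carry `s = |S| + |R|` letters, `|N| = |S| + 2|R|`. The single positions
cut `N` into blocks, and by criticality a block has at least half as many letters as positions. So
there are at least `|S| / 2 + |R|` last occurrences of a letter in a block; all but at most `|R|` of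
them are followed by the same letter in a later block, hence start a separated pair. -/
theorem card_singles_le_two_mul_card_separatedPairs {w : ℕ → V} {s : ℕ}
    (hw : IsCriticalWord w s) :
    (singles w (2 * s)).card ≤ 2 * (separatedPairs w (2 * s)).card := by
  classical
  set m := 2 * s with hm
  set N := Finset.range m \ singles w m with hN
  -- the number of the transition block that contains a position
  let d : ℕ → ℕ := fun t => ((singles w m).filter (· < t)).card
  have hd_mono : ∀ {t t'}, t ≤ t' → d t ≤ d t' := fun h => Finset.card_le_card
    (Finset.monotone_filter_right _ fun q _ hq => lt_of_lt_of_le hq h)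
  have hd_lt : ∀ {t t' q}, q ∈ singles w m → t ≤ q → q < t' → d t < d t' := by
    intro t t' q hq h1 h2
    apply Finset.card_lt_card
    refine Finset.ssubset_iff_subset_ne.2 ⟨Finset.monotone_filter_right _ fun r _ hr =>
      lt_trans hr (lt_of_le_of_lt h1 h2), fun h => ?_⟩
    have : q ∈ (singles w m).filter (· < t') := Finset.mem_filter.2 ⟨hq, h2⟩
    rw [← h, Finset.mem_filter] at this
    omega
  have hsub : singles w m ⊆ Finset.range m := Finset.filter_subset _ _
  have hNcard : N.card + (singles w m).card = m := by
    rw [hN, Finset.card_sdiff_add_card_eq_card hsub, Finset.card_range]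
  have hsr := card_singles_add_card_repeated w m
  rw [hm, hw.card_eq, ← hm] at hsr
  -- at most half of the positions in a transition block are lost when passing to letters
  have hfib : N.card ≤ 2 * (N.image fun t => (w t, d t)).card := by
    rw [Finset.card_eq_sum_card_image d N,
      Finset.card_eq_sum_card_fiberwise (f := Prod.snd) (s := N.image fun t => (w t, d t))
        (t := N.image d) (by
          intro p hp
          simp only [Finset.coe_image, Set.mem_image, Finset.mem_coe] at hp ⊢
          obtain ⟨t, ht, rfl⟩ := hp
          exact ⟨t, ht, rfl⟩), Finset.mul_sum]
    refine Finset.sum_le_sum fun c hc => ?_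
    set F := N.filter fun t => d t = c with hF
    have hFne : F.Nonempty := by
      obtain ⟨t, ht, htc⟩ := Finset.mem_image.1 hc
      exact ⟨t, Finset.mem_filter.2 ⟨ht, htc⟩⟩
    have hmin := Finset.mem_filter.1 (F.min'_mem hFne)
    have hmax := Finset.mem_filter.1 (F.max'_mem hFne)
    set a := F.min' hFne
    set b := F.max' hFne
    have hbm : b < m := by
      have := hmax.1
      simp only [hN, Finset.mem_sdiff, Finset.mem_range] at this
      exact this.1
    have hbs : b ∉ singles w m := by
      have := hmax.1
      simp only [hN, Finset.mem_sdiff] at this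
      exact this.2
    -- A single position inside would raise `d`, so a block is a full interval and the bound on
    -- subwords applies.
    have hFI : F = Finset.Ico a (b + 1) := by
      ext t
      rw [Finset.mem_Ico]
      constructor
      · intro ht
        exact ⟨F.min'_le t ht, Nat.lt_succ_of_le (F.le_max' t ht)⟩
      · rintro ⟨h1, h2⟩
        have h2' : t ≤ b := by omega
        have hda := hd_mono h1
        have hdb := hd_mono h2'
        refine Finset.mem_filter.2 ⟨?_, by omega⟩
        simp only [hN, Finset.mem_sdiff, Finset.mem_range]
        refine ⟨by omega, fun hts => ?_⟩
        have htb : t < b := lt_of_le_of_ne h2' (fun h => hbs (h ▸ hts))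
        have := hd_lt hts le_rfl htb
        omega
    calc F.card = b + 1 - a := by rw [hFI, Nat.card_Ico]
      _ ≤ 2 * ((Finset.Ico a (b + 1)).image w).card := hw.le_card a (b + 1) (by omega)
      _ ≤ _ := by
        refine Nat.mul_le_mul_left 2 ?_
        rw [← hFI]
        apply Finset.card_le_card_of_injOn (fun v => (v, c))
        · intro v hv
          simp only [Finset.coe_image, Set.mem_image, Finset.mem_coe] at hv
          obtain ⟨t, ht, rfl⟩ := hv
          have ht' := Finset.mem_filter.1 ht
          simp only [Finset.coe_filter, Finset.mem_image, Set.mem_ofPred_eq, and_true]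
          exact ⟨t, ht'.1, by rw [ht'.2]⟩
        · intro v _ v' _ h
          exact (Prod.mk.inj h).1
  -- the last occurrences of the letters in the transition blocks
  let last := N.filter fun t => ∀ t' ∈ N, w t' = w t → d t' = d t → t' ≤ t
  have hlast : (N.image fun t => (w t, d t)).card ≤ last.card := by
    apply Finset.card_le_card_of_surjOn (fun t => (w t, d t))
    intro p hp
    simp only [Finset.coe_image, Set.mem_image, Finset.mem_coe] at hp ⊢
    obtain ⟨t, ht, rfl⟩ := hp
    have hne : (N.filter fun t' => w t' = w t ∧ d t' = d t).Nonempty :=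
      ⟨t, Finset.mem_filter.2 ⟨ht, rfl, rfl⟩⟩
    have hmem := Finset.mem_filter.1 (Finset.max'_mem _ hne)
    refine ⟨_, Finset.mem_filter.2 ⟨hmem.1, fun t' ht' h1 h2 => ?_⟩, by rw [hmem.2.1, hmem.2.2]⟩
    exact Finset.le_max' _ _ (Finset.mem_filter.2 ⟨ht', h1.trans hmem.2.1, h2.trans hmem.2.2⟩)
  have hsplit := Finset.card_filter_add_card_filter_not (s := last)
    (fun t => ∃ t' ∈ N, w t' = w t ∧ t < t')
  have hN_rep : ∀ t ∈ N, t < m ∧ w t ∈ repeated w m := by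
    intro t ht
    simp only [hN, Finset.mem_sdiff, Finset.mem_range] at ht
    exact ⟨ht.1, (mem_singles_or_repeated w ht.1).resolve_left ht.2⟩
  have hA : (last.filter fun t => ∃ t' ∈ N, w t' = w t ∧ t < t').card ≤
      (separatedPairs w m).card := by
    apply Finset.card_le_card_of_surjOn Prod.fst
    intro t ht
    obtain ⟨htl, t', ht', hwt, htt⟩ := Finset.mem_filter.1 (Finset.mem_coe.1 ht)
    obtain ⟨htN, hmaxt⟩ := Finset.mem_filter.1 htl
    obtain ⟨j, hj, hs⟩ := exists_successive htt hwt
    have htm := (hN_rep t' ht').1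
    have hjN : j ∈ N := by
      simp only [hN, Finset.mem_sdiff, Finset.mem_range]
      refine ⟨by omega, fun hjs => ?_⟩
      have := eq_of_mem_singles hjs (by have := hs.lt; omega : t < m) hs.eq
      have := hs.lt
      omega
    have hdne : d j ≠ d t := fun h => by
      have := hmaxt j hjN hs.eq.symm h
      have := hs.lt
      omega
    have hq : ∃ q ∈ singles w m, t < q ∧ q < j := by
      by_contra hno
      push Not at hno
      apply hdne
      refine congrArg Finset.card (Finset.filter_congr fun q hq => ?_)
      constructor
      · intro hqj
        by_contra hqt
        rcases eq_or_lt_of_le (not_lt.1 hqt) with h | h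
        · subst h
          simp only [hN, Finset.mem_sdiff] at htN
          exact htN.2 hq
        · have := hno q hq h
          omega
      · intro hqt
        exact hqt.trans hs.lt
    refine ⟨(t, j), ?_, rfl⟩
    simp only [separatedPairs, Finset.coe_filter, Finset.mem_product, Finset.mem_range,
      Set.mem_ofPred_eq]
    exact ⟨⟨by have := hs.lt; omega, by omega⟩, hs, hq⟩
  have hB : (last.filter fun t => ¬ ∃ t' ∈ N, w t' = w t ∧ t < t').card ≤
      (repeated w m).card := by
    apply Finset.card_le_card_of_injOn w
    · intro t ht
      exact (hN_rep t (Finset.mem_filter.1 (Finset.mem_filter.1 (Finset.mem_coe.1 ht)).1).1).2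
    · intro t ht t' ht' h
      obtain ⟨htl, hno⟩ := Finset.mem_filter.1 (Finset.mem_coe.1 ht)
      obtain ⟨htl', hno'⟩ := Finset.mem_filter.1 (Finset.mem_coe.1 ht')
      push Not at hno hno'
      exact le_antisymm (hno' t (Finset.mem_filter.1 htl).1 h)
        (hno t' (Finset.mem_filter.1 htl').1 h.symm)
  omega

end Words

/-- A critical word with `s` letters has at least `s / 4` pairs of successive positions, each with a
pivot letter, such that the pairs of letters (repeated letter, pivot letter) are triangular. -/
theorem IsCriticalWord.exists_triangular {n : ℕ} {w : ℕ → Fin n} {s : ℕ}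
    (hw : IsCriticalWord w s) :
    ∃ (I : Finset (ℕ × ℕ)) (u : ℕ × ℕ → Fin n) (ord : ℕ × ℕ → ℕ), s ≤ 4 * I.card ∧
      (∀ k ∈ I, k.2 < 2 * s ∧ Successive w k.1 k.2 ∧ u k ≠ w k.1 ∧ Odd (occ w k.1 k.2 (u k))) ∧
      ∀ k ∈ I, ∀ l ∈ I, k ≠ l → ord l ≤ ord k → ∀ x, s(w l.1, x) = s(w k.1, u k) →
        ¬ Odd (occ w l.1 l.2 x) := by
  classical
  have hsr := card_singles_add_card_repeated w (2 * s)
  rw [hw.card_eq] at hsr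
  have hsing := card_singles_le_two_mul_card_separatedPairs hw
  -- Otherwise fewer than `s / 2` letters are single, so at least `s / 2` are repeated. Here the
  -- pivot is a single letter inside the gap. Another form containing the pivot edge would belong
  -- either to the pivot letter, which has no successive pair, or to the same repeated letter with a
  -- gap containing the same single position, hence to the same pair.
  by_cases hcase : s ≤ 4 * (separatedPairs w (2 * s)).card
  · have hmem : ∀ k ∈ separatedPairs w (2 * s), k.2 < 2 * s ∧ Successive w k.1 k.2 ∧
        ∃ q ∈ singles w (2 * s), k.1 < q ∧ q < k.2 := by
      intro k hk
      simp only [separatedPairs, Finset.mem_filter, Finset.mem_product, Finset.mem_range] at hk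
      exact ⟨hk.1.2, hk.2⟩
    choose! h1 h2 q hq1 hq2 hq3 using hmem
    refine ⟨separatedPairs w (2 * s), fun k => w (q k), fun _ => 0, hcase, fun k hk => ?_,
      fun k hk l hl hkl _ x hx hodd => ?_⟩
    · refine ⟨h1 k hk, h2 k hk, (h2 k hk).ne _ (hq2 k hk) (hq3 k hk), ?_⟩
      have : occ w k.1 k.2 (w (q k)) = 1 := by
        rw [occ, Finset.card_eq_one]
        refine ⟨q k, Finset.ext fun t => ?_⟩
        simp only [Finset.mem_filter, Finset.mem_Ico, Finset.mem_singleton]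
        constructor
        · rintro ⟨⟨_, h⟩, h'⟩
          exact eq_of_mem_singles (hq1 k hk) (h.trans (h1 k hk)) h'
        · rintro h
          rw [h]
          exact ⟨⟨(hq2 k hk).le, hq3 k hk⟩, rfl⟩
      rw [this]
      exact odd_one
    · have hl1 : l.1 < 2 * s := (h2 l hl).lt.trans (h1 l hl)
      rw [Sym2.eq_iff] at hx
      rcases hx with ⟨ha, rfl⟩ | ⟨ha, rfl⟩
      · obtain ⟨t, ht⟩ := Finset.card_pos.1 hodd.pos
        simp only [Finset.mem_filter, Finset.mem_Ico] at ht
        have htq := eq_of_mem_singles (hq1 k hk) (ht.1.2.trans (h1 l hl)) ht.2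
        have hlt : l.1 ≠ q k := by
          intro h
          exact (h2 k hk).ne _ (hq2 k hk) (hq3 k hk) (h ▸ ha)
        have h11 := (h2 k hk).fst_eq_of_overlap (h2 l hl) ha.symm (hq2 k hk) (hq3 k hk)
          (lt_of_le_of_ne (htq ▸ ht.1.1) hlt) (htq ▸ ht.1.2)
        have hl' := h2 l hl
        rw [← h11] at hl'
        exact hkl (Prod.ext h11 ((h2 k hk).snd_eq hl'))
      · have := eq_of_mem_singles (hq1 k hk) hl1 ha
        have h' := (h2 l hl).eq
        rw [this] at h'
        have := eq_of_mem_singles (hq1 k hk) (h1 l hl) h'.symm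
        have := (h2 l hl).lt
        omega
  -- Here one pair is kept per repeated letter `v`, with an odd pivot letter `u`, and only those
  -- with `v < u` or only those with `u < v`, whichever are more numerous: at least `s / 4`. Another
  -- form containing the edge `vu` must belong to the letter `u`, which comes later in the order.
  · have : Nonempty (Fin n) := ⟨w 0⟩
    have hrep : s ≤ 2 * (repeated w (2 * s)).card := by omega
    have hodd : ∀ k : ℕ × ℕ, k.2 < 2 * s → Successive w k.1 k.2 →
        ∃ u ≠ w k.1, Odd (occ w k.1 k.2 u) := fun k => hw.exists_odd k.1 k.2
    choose! u hu1 hu2 using hodd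
    have hpair : ∀ v ∈ repeated w (2 * s), ∃ k : ℕ × ℕ, k.2 < 2 * s ∧ w k.1 = v ∧
        Successive w k.1 k.2 := by
      intro v hv
      obtain ⟨i, j, h⟩ := exists_successive_of_mem_repeated hv
      exact ⟨(i, j), h⟩
    have : ∃ f : Fin n → ℕ × ℕ, ∀ v ∈ repeated w (2 * s), (f v).2 < 2 * s ∧ w (f v).1 = v ∧
        Successive w (f v).1 (f v).2 := by
      refine ⟨fun v => if h : v ∈ repeated w (2 * s) then (hpair v h).choose else (0, 0),
        fun v hv => ?_⟩
      simp only [dif_pos hv]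
      exact (hpair v hv).choose_spec
    obtain ⟨f, hf⟩ := this
    have main : ∀ (p : Fin n → Fin n → Prop) [DecidableRel p] (ord : Fin n → ℕ),
        (∀ v v', p v v' → ord v < ord v') →
        s ≤ 4 * ((repeated w (2 * s)).filter fun v => p v (u (f v))).card →
        ∃ (I : Finset (ℕ × ℕ)) (u : ℕ × ℕ → Fin n) (ord : ℕ × ℕ → ℕ), s ≤ 4 * I.card ∧
        (∀ k ∈ I, k.2 < 2 * s ∧ Successive w k.1 k.2 ∧ u k ≠ w k.1 ∧
          Odd (occ w k.1 k.2 (u k))) ∧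
        ∀ k ∈ I, ∀ l ∈ I, k ≠ l → ord l ≤ ord k → ∀ x, s(w l.1, x) = s(w k.1, u k) →
          ¬ Odd (occ w l.1 l.2 x) := by
      intro p _ ord hp hcard
      set A := (repeated w (2 * s)).filter fun v => p v (u (f v)) with hA
      have hAf : ∀ v ∈ A, ((f v).2 < 2 * s ∧ w (f v).1 = v ∧ Successive w (f v).1 (f v).2) ∧
          p v (u (f v)) := fun v hv =>
        ⟨hf v (Finset.mem_filter.1 hv).1, (Finset.mem_filter.1 hv).2⟩
      refine ⟨A.image f, u, fun k => ord (w k.1), ?_, ?_, ?_⟩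
      · rw [Finset.card_image_of_injOn]
        · exact hcard
        · intro v hv v' hv' h
          rw [← (hAf v hv).1.2.1, ← (hAf v' hv').1.2.1, h]
      · intro k hk
        obtain ⟨v, hv, rfl⟩ := Finset.mem_image.1 hk
        obtain ⟨⟨h1, -, h3⟩, -⟩ := hAf v hv
        exact ⟨h1, h3, hu1 _ h1 h3, hu2 _ h1 h3⟩
      · intro k hk l hl hkl hord x hx _
        obtain ⟨v, hv, rfl⟩ := Finset.mem_image.1 hk
        obtain ⟨v', hv', rfl⟩ := Finset.mem_image.1 hl
        obtain ⟨⟨-, h2, -⟩, h4⟩ := hAf v hv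
        obtain ⟨⟨-, h2', -⟩, -⟩ := hAf v' hv'
        simp only [h2, h2'] at hord hx
        rw [Sym2.eq_iff] at hx
        rcases hx with ⟨ha, -⟩ | ⟨ha, -⟩
        · exact hkl (by rw [ha])
        · have := hp _ _ h4
          rw [ha] at hord
          omega
    have hsplit := Finset.card_filter_add_card_filter_not (s := repeated w (2 * s))
      (fun v => v < u (f v))
    rcases le_or_gt s (4 * ((repeated w (2 * s)).filter fun v => v < u (f v)).card) with h | h
    · exact main (fun v v' => v < v') (fun v => v) (fun v v' h => h) h
    · refine main (fun v v' => v' < v) (fun v => n - v) (fun v v' h => by omega) ?_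
      have : ((repeated w (2 * s)).filter fun v => ¬ v < u (f v)) =
          (repeated w (2 * s)).filter fun v => u (f v) < v := by
        refine Finset.filter_congr fun v hv => ?_
        obtain ⟨h1, h2, h3⟩ := hf v hv
        have := hu1 (f v) h1 h3
        rw [h2] at this
        rw [not_lt]
        exact ⟨fun h => lt_of_le_of_ne h this, le_of_lt⟩
      rw [← this]
      omega

/-- A word whose length is twice the size of the alphabet contains a subword whose length is twice
its number of letters, and which is minimal with this property. -/
theorem exists_critical_subword {n : ℕ} (hn : 0 < n) (w : ℕ → Fin n) :
    ∃ a s, 1 ≤ s ∧ s ≤ n ∧ a + 2 * s ≤ 2 * n ∧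
      ((Finset.Ico a (a + 2 * s)).image w).card = s ∧
      ∀ b c, a ≤ b → c ≤ a + 2 * s → c - b ≤ 2 * ((Finset.Ico b c).image w).card := by
  have hcard : ∀ S : Finset ℕ, (S.image w).card ≤ n := fun S => by
    simpa using (S.image w).card_le_univ
  -- The subword is a shortest one with at least twice as many positions as letters; the whole word
  -- is a candidate.
  have hex : ∃ ℓ, 0 < ℓ ∧ ∃ a, a + ℓ ≤ 2 * n ∧ 2 * ((Finset.Ico a (a + ℓ)).image w).card ≤ ℓ :=
    ⟨2 * n, by omega, 0, by omega, Nat.mul_le_mul_left 2 (hcard _)⟩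
  classical
  obtain ⟨hℓ, a, ha, hle⟩ := Nat.find_spec hex
  have hmin := fun k (hk : k < Nat.find hex) => Nat.find_min hex hk
  set ℓ := Nat.find hex
  have hsub : ∀ b c, a ≤ b → c ≤ a + ℓ → c - b < ℓ →
      c - b ≤ 2 * ((Finset.Ico b c).image w).card := by
    intro b c hb hc hlt
    by_contra hno
    refine hmin (c - b) hlt ⟨by omega, b, by omega, ?_⟩
    rw [show b + (c - b) = c by omega]
    omega
  have hcons : ((Finset.Ico a (a + ℓ)).image w).card ≤
      ((Finset.Ico a (a + ℓ - 1)).image w).card + 1 := by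
    have : Finset.Ico a (a + ℓ) = insert (a + ℓ - 1) (Finset.Ico a (a + ℓ - 1)) := by
      ext t
      simp only [Finset.mem_insert, Finset.mem_Ico]
      omega
    rw [this, Finset.image_insert]
    exact Finset.card_insert_le _ _
  have hmono : ((Finset.Ico a (a + ℓ - 1)).image w).card ≤
      ((Finset.Ico a (a + ℓ)).image w).card :=
    Finset.card_le_card (Finset.image_subset_image (Finset.Ico_subset_Ico_right (by omega)))
  have hpos : 0 < ((Finset.Ico a (a + ℓ)).image w).card :=
    Finset.card_pos.2 ⟨w a, Finset.mem_image_of_mem _ (by simp; omega)⟩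
  -- Dropping the last position violates the inequality by minimality, which forces the ratio to be
  -- exactly two.
  have hlt : ℓ - 1 < 2 * ((Finset.Ico a (a + ℓ - 1)).image w).card := by
    by_contra hno
    refine hmin (ℓ - 1) (by omega) ⟨by omega, a, by omega, ?_⟩
    rw [show a + (ℓ - 1) = a + ℓ - 1 by omega]
    omega
  have heq : ℓ = 2 * ((Finset.Ico a (a + ℓ)).image w).card := by omega
  refine ⟨a, ((Finset.Ico a (a + ℓ)).image w).card, hpos, hcard _, by omega, by rw [← heq], ?_⟩
  rw [← heq]
  intro b c hb hc
  by_cases hbc : c - b < ℓ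
  · exact hsub b c hb hc hbc
  · have h1 : b = a := by omega
    have h2 : c = a + ℓ := by omega
    subst h1 h2
    omega

/-! ### Gains of moves as linear forms in the weights -/

theorem spinProd_mk {V : Type*} (σ : Config V) (u v : V) :
    spinProd σ s(u, v) = ((σ u : ℤ) : ℝ) * ((σ v : ℤ) : ℝ) := rfl

theorem IsImprovingSeq.hamiltonian_le {V : Type*} [Fintype V] {G : SimpleGraph V}
    [Fintype G.edgeSet] {x : G.edgeSet → ℝ} {ℓ : ℕ} {σ : ℕ → Config V}
    (h : IsImprovingSeq x ℓ σ) {a b : ℕ} (hab : a ≤ b) (hb : b ≤ ℓ) :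
    hamiltonian x (σ a) ≤ hamiltonian x (σ b) := by
  induction b, hab using Nat.le_induction with
  | base => exact le_rfl
  | succ b hab ih => exact (ih (by omega)).trans (h b (by omega)).2.le

section Gains

variable {V : Type*} [DecidableEq V]

/-- The configuration obtained from `σ` by flipping the spin at `v`. -/
def flip (σ : Config V) (v : V) : Config V := Function.update σ v (-σ v)

/-- The configuration obtained from `σ` by flipping the first `t` letters of the word `w`. -/
def flips (σ : Config V) (w : ℕ → V) (t : ℕ) : Config V := fun u => σ u * (-1) ^ occ w 0 t u

theorem flips_zero (σ : Config V) (w : ℕ → V) : flips σ w 0 = σ := by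
  funext u
  simp [flips, occ]

theorem flips_succ (σ : Config V) (w : ℕ → V) (t : ℕ) :
    flips σ w (t + 1) = flip (flips σ w t) (w t) := by
  funext u
  rw [flip, flips, occ_succ w (Nat.zero_le t)]
  by_cases h : w t = u
  · subst h
    simp [flips, pow_succ]
  · rw [Function.update_of_ne (Ne.symm h)]
    simp [flips, h]

theorem flips_eq_mul (σ : Config V) (w : ℕ → V) {i j : ℕ} (hij : i ≤ j) (u : V) :
    flips σ w j u = flips σ w i u * (-1) ^ occ w i j u := by
  rw [flips, flips, occ_split w (Nat.zero_le i) hij, pow_add, mul_assoc]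

theorem eq_flips_of_forall_eq_flip {σ : ℕ → Config V} {w : ℕ → V} {m : ℕ}
    (h : ∀ t < m, σ (t + 1) = flip (σ t) (w t)) : ∀ t ≤ m, σ t = flips (σ 0) w t := by
  intro t ht
  induction t with
  | zero => rw [flips_zero]
  | succ t ih => rw [h t (by omega), ih (by omega), flips_succ]

variable {G : SimpleGraph V}

/-- The coefficients of the gain of flipping the spin at `v`. -/
def gainForm (σ : Config V) (v : V) (e : G.edgeSet) : ℝ :=
  if v ∈ (e : Sym2 V) then spinProd σ e else 0

/-- The coefficients of the total gain of the moves at the positions `i` and `j` of the word `w`,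
if both positions carry the same letter. -/
def pairForm (σ : Config V) (w : ℕ → V) (i j : ℕ) (e : G.edgeSet) : ℝ :=
  gainForm (flips σ w i) (w i) e + gainForm (flips σ w j) (w i) e

theorem pairForm_eq_zero {σ : Config V} {w : ℕ → V} {i j : ℕ} {e : G.edgeSet}
    (h : w i ∉ (e : Sym2 V)) : pairForm σ w i j e = 0 := by
  simp [pairForm, gainForm, h]

/-- The vertex `w i` moves exactly once in `[i, j)`, so its spin is reversed and the two
contributions of an edge cancel unless the other end moved an odd number of times. -/
theorem pairForm_eq {σ : Config V} {w : ℕ → V} {i j : ℕ} (h : Successive w i j) {u : V}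
    {e : G.edgeSet} (he : (e : Sym2 V) = s(w i, u)) :
    pairForm σ w i j e = ((flips σ w i (w i) : ℤ) : ℝ) * ((flips σ w i u : ℤ) : ℝ) *
      (1 - (-1) ^ occ w i j u) := by
  have hv : w i ∈ (e : Sym2 V) := he ▸ Sym2.mem_mk_left _ _
  rw [pairForm, gainForm, gainForm, if_pos hv, if_pos hv, he, spinProd_mk, spinProd_mk,
    flips_eq_mul σ w h.lt.le (w i), flips_eq_mul σ w h.lt.le u, h.occ_eq_one]
  push_cast
  ring

theorem pairForm_eq_zero_of_not_odd {σ : Config V} {w : ℕ → V} {i j : ℕ} (h : Successive w i j)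
    {u : V} {e : G.edgeSet} (he : (e : Sym2 V) = s(w i, u)) (hu : ¬ Odd (occ w i j u)) :
    pairForm σ w i j e = 0 := by
  rw [pairForm_eq h he, (Nat.not_odd_iff_even.1 hu).neg_one_pow, sub_self, mul_zero]

theorem abs_spin (a : ℤˣ) : |((a : ℤ) : ℝ)| = 1 := by
  rcases Int.units_eq_one_or a with rfl | rfl <;> simp

theorem one_le_abs_pairForm {σ : Config V} {w : ℕ → V} {i j : ℕ} (h : Successive w i j)
    {u : V} {e : G.edgeSet} (he : (e : Sym2 V) = s(w i, u)) (hu : Odd (occ w i j u)) :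
    1 ≤ |pairForm σ w i j e| := by
  rw [pairForm_eq h he, hu.neg_one_pow, abs_mul, abs_mul, abs_spin, abs_spin]
  norm_num

/-- The total gain of two successive moves of a vertex does not depend on the spins of the vertices
that are never moved. -/
theorem pairForm_congr {σ σ' : Config V} {w : ℕ → V} {m : ℕ}
    (hσ : ∀ t < m, σ (w t) = σ' (w t)) {i j : ℕ} (h : Successive w i j) (hj : j ≤ m)
    (e : G.edgeSet) : pairForm σ w i j e = pairForm σ' w i j e := by
  by_cases hv : w i ∈ (e : Sym2 V)
  · obtain ⟨u, hu⟩ := hv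
    by_cases hodd : Odd (occ w i j u)
    · obtain ⟨t, ht⟩ := Finset.card_pos.1 hodd.pos
      simp only [Finset.mem_filter, Finset.mem_Ico] at ht
      have h1 : σ u = σ' u := ht.2 ▸ hσ t (by omega)
      have h2 : σ (w i) = σ' (w i) := hσ i (by have := h.lt; omega)
      rw [pairForm_eq h hu, pairForm_eq h hu]
      simp only [flips, h1, h2]
    · rw [pairForm_eq_zero_of_not_odd h hu hodd, pairForm_eq_zero_of_not_odd h hu hodd]
  · rw [pairForm_eq_zero hv, pairForm_eq_zero hv]

/-- Source of the last condition in `IsCriticalWord`: two improving moves have positive total gain,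
so their form is not zero. -/
theorem exists_odd_of_pairForm_ne_zero {σ : Config V} {w : ℕ → V} {i j : ℕ}
    (h : Successive w i j) {e : G.edgeSet} (he : pairForm σ w i j e ≠ 0) :
    ∃ u ≠ w i, Odd (occ w i j u) := by
  by_cases hv : w i ∈ (e : Sym2 V)
  · obtain ⟨u, hu⟩ := hv
    refine ⟨u, ?_, ?_⟩
    · rintro rfl
      exact G.loopless.irrefl _ (G.mem_edgeSet.1 (hu ▸ e.2))
    · by_contra hodd
      exact he (pairForm_eq_zero_of_not_odd h hu hodd)
  · exact absurd (pairForm_eq_zero hv) he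

variable [Fintype G.edgeSet]

theorem hamiltonian_flip (x : G.edgeSet → ℝ) (σ : Config V) (v : V) :
    hamiltonian x (flip σ v) - hamiltonian x σ = ∑ e, gainForm σ v e * x e := by
  rw [hamiltonian, hamiltonian, ← mul_sub, ← Finset.sum_sub_distrib, Finset.mul_sum]
  refine Finset.sum_congr rfl fun e _ => ?_
  by_cases hv : v ∈ (e : Sym2 V)
  · obtain ⟨u, hu⟩ := hv
    have huv : u ≠ v := by
      rintro rfl
      exact G.loopless.irrefl _ (G.mem_edgeSet.1 (hu ▸ e.2))
    rw [gainForm, if_pos (hu ▸ Sym2.mem_mk_left _ _), hu, spinProd_mk, spinProd_mk, flip,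
      Function.update_self, Function.update_of_ne huv]
    push_cast
    ring
  · have : spinProd (flip σ v) e = spinProd σ e := by
      obtain ⟨e, he⟩ := e
      induction e using Sym2.ind with
      | _ a b =>
        simp only [Sym2.mem_iff, not_or] at hv
        rw [spinProd_mk, spinProd_mk, flip, Function.update_of_ne (Ne.symm hv.1),
          Function.update_of_ne (Ne.symm hv.2)]
    rw [gainForm, if_neg hv, this]
    ring

theorem IsImprovingMove.exists_flip [Fintype V] {x : G.edgeSet → ℝ} {σ σ' : Config V}
    (h : IsImprovingMove x σ σ') : ∃ v, σ' = flip σ v := by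
  have h1 := h.1
  obtain ⟨v, hv⟩ := Finset.card_eq_one.1 (show (Finset.univ.filter fun i => σ' i ≠ σ i).card = 1
    by rw [hammingDist] at h1; convert h1)
  refine ⟨v, funext fun u => ?_⟩
  have hu : σ' u ≠ σ u ↔ u = v := by
    have := Finset.ext_iff.1 hv u
    simpa using this
  by_cases huv : u = v
  · subst huv
    rw [flip, Function.update_self]
    exact Int.units_ne_iff_eq_neg.1 (hu.2 rfl)
  · rw [flip, Function.update_of_ne huv]
    by_contra hne
    exact huv (hu.1 hne)

end Gains

/-! ### Finite codes for words and their starting spins. -/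

section Encoding

variable {V : Type*} {m : ℕ}

/-- The word given by the first components of `f`, continued arbitrarily. -/
def codeWord [Nonempty V] (f : Fin m → V × ℤˣ) (i : ℕ) : V :=
  if h : i < m then (f ⟨i, h⟩).1 else Classical.arbitrary V

open Classical in
/-- A configuration whose spins at the letters of the word `codeWord f` are given by the second
components of `f`. -/
def codeConfig (f : Fin m → V × ℤˣ) : Config V := fun u =>
  if h : ∃ i, (f i).1 = u then (f h.choose).2 else 1

theorem codeWord_mk [Nonempty V] (w : ℕ → V) (σ : Config V) {i : ℕ} (hi : i < m) :
    codeWord (fun t : Fin m => (w t, σ (w t))) i = w i := by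
  simp [codeWord, hi]

theorem codeConfig_mk (w : ℕ → V) (σ : Config V) {i : ℕ} (hi : i < m) :
    codeConfig (fun t : Fin m => (w t, σ (w t))) (w i) = σ (w i) := by
  have h : ∃ t : Fin m, w t = w i := ⟨⟨i, hi⟩, rfl⟩
  rw [codeConfig, dif_pos h]
  exact congrArg σ h.choose_spec

end Encoding

/-- If `2 n` consecutive improving moves have a small total gain, then the gains of successive moves
of a vertex are small along a critical word. -/
theorem IsImprovingSeq.exists_isCriticalWord {n : ℕ} [Nonempty (Fin n)]
    {G : SimpleGraph (Fin n)} [Fintype G.edgeSet] {x : G.edgeSet → ℝ} {σ : ℕ → Config (Fin n)}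
    {ε : ℝ} (h : IsImprovingSeq x (2 * n) σ)
    (hε : hamiltonian x (σ (2 * n)) - hamiltonian x (σ 0) ≤ ε) :
    ∃ s ∈ Finset.Icc 1 n, ∃ f : Fin (2 * s) → Fin n × ℤˣ, IsCriticalWord (codeWord f) s ∧
      ∀ i j, j < 2 * s → Successive (codeWord f) i j →
        ∑ e, pairForm (G := G) (codeConfig f) (codeWord f) i j e * x e ∈ Set.Icc 0 (2 * ε) := by
  have hflip : ∀ t, ∃ v, t < 2 * n → σ (t + 1) = flip (σ t) v := by
    intro t
    by_cases ht : t < 2 * n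
    · obtain ⟨v, hv⟩ := (h t ht).exists_flip
      exact ⟨v, fun _ => hv⟩
    · exact ⟨Classical.arbitrary _, fun h => absurd h ht⟩
  choose w hw using hflip
  obtain ⟨a, s, hs1, hsn, has, hcard, hle⟩ := exists_critical_subword (Fin.pos_iff_nonempty.2
    inferInstance) w
  let f : Fin (2 * s) → Fin n × ℤˣ := fun t => (w (a + t), σ a (w (a + t)))
  have hcw : ∀ i < 2 * s, codeWord f i = w (a + i) := fun i hi =>
    codeWord_mk (fun t => w (a + t)) (σ a) hi
  have hcc : ∀ t < 2 * s, σ a (codeWord f t) = codeConfig f (codeWord f t) := by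
    intro t ht
    rw [hcw t ht]
    exact (codeConfig_mk (fun t => w (a + t)) (σ a) ht).symm
  have himage : ∀ b c, c ≤ 2 * s → (Finset.Ico b c).image (codeWord f) =
      (Finset.Ico (a + b) (a + c)).image w := by
    intro b c hc
    rw [← Finset.image_add_left_Ico, Finset.image_image]
    refine Finset.image_congr fun i hi => ?_
    rw [Finset.mem_coe, Finset.mem_Ico] at hi
    exact hcw i (by omega)
  have hconf : ∀ t ≤ 2 * s, σ (a + t) = flips (σ a) (codeWord f) t :=
    eq_flips_of_forall_eq_flip (σ := fun t => σ (a + t)) (fun t ht => by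
      rw [hcw t ht]
      exact hw (a + t) (by omega))
  -- All gains are positive, so each one is at most the total gain.
  have hgain : ∀ t < 2 * s,
      0 < ∑ e, gainForm (G := G) (flips (σ a) (codeWord f) t) (codeWord f t) e * x e ∧
      ∑ e, gainForm (G := G) (flips (σ a) (codeWord f) t) (codeWord f t) e * x e ≤ ε := by
    intro t ht
    rw [← hamiltonian_flip, ← flips_succ, ← hconf t ht.le, ← hconf (t + 1) ht, ← add_assoc]
    have h1 := (h (a + t) (by omega)).2
    have h2 := h.hamiltonian_le (Nat.zero_le (a + t)) (by omega)
    have h3 := h.hamiltonian_le (show a + t + 1 ≤ 2 * n by omega) le_rfl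
    exact ⟨by linarith, by linarith⟩
  have hpair : ∀ i j, j < 2 * s → Successive (codeWord f) i j →
      0 < ∑ e, pairForm (G := G) (σ a) (codeWord f) i j e * x e ∧
      ∑ e, pairForm (G := G) (σ a) (codeWord f) i j e * x e ≤ 2 * ε := by
    intro i j hj hij
    have hi := hgain i (hij.lt.trans hj)
    have hj := hgain j hj
    rw [← hij.eq] at hj
    simp only [pairForm, add_mul, Finset.sum_add_distrib]
    exact ⟨by linarith, by linarith⟩
  refine ⟨s, Finset.mem_Icc.2 ⟨hs1, hsn⟩, f, ⟨?_, ?_, ?_⟩, ?_⟩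
  · rw [himage 0 (2 * s) le_rfl]
    exact hcard
  · intro b c hc
    rw [himage b c hc]
    have := hle (a + b) (a + c) (by omega) (by omega)
    omega
  · intro i j hj hij
    obtain ⟨e, -, he⟩ := Finset.exists_ne_zero_of_sum_ne_zero (hpair i j hj hij).1.ne'
    exact exists_odd_of_pairForm_ne_zero hij (left_ne_zero_of_mul he)
  · intro i j hj hij
    simp only [← fun e : G.edgeSet => pairForm_congr hcc hij hj.le e]
    have := hpair i j hj hij
    exact ⟨this.1.le, this.2⟩

/-! ### The union bound -/

section UnionBound

variable {n : ℕ} [Fintype (⊤ : SimpleGraph (Fin n)).edgeSet] {Ω : Type*} [MeasurableSpace Ω] {P : Measure Ω}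
  [IsProbabilityMeasure P] {X : (⊤ : SimpleGraph (Fin n)).edgeSet → Ω → ℝ} {φ : ℝ}

/-- The exponent `4` in `y ^ 4` makes up for having only `s / 4` triangular forms. -/
theorem IsSmoothedWeights.measure_isCriticalWord_le (hX : IsSmoothedWeights P X φ) {s : ℕ}
    {w : ℕ → Fin n} (hw : IsCriticalWord w s) (σ : Config (Fin n)) {L y : ℝ} (hy0 : 0 ≤ y)
    (hy1 : y ≤ 1) (hφ : 0 ≤ φ) (hL : φ * L ≤ y ^ 4) :
    P {ω | ∀ i j, j < 2 * s → Successive w i j →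
      ∑ e, pairForm (G := ⊤) σ w i j e * X e ω ∈ Set.Icc 0 L} ≤ ENNReal.ofReal y ^ s := by
  obtain ⟨I, u, ord, hcard, hI, htri⟩ := hw.exists_triangular
  have hex : ∀ k ∈ I, ∃ e : (⊤ : SimpleGraph (Fin n)).edgeSet, (e : Sym2 (Fin n)) =
      s(w k.1, u k) := fun k hk =>
    ⟨⟨s(w k.1, u k), by simpa using (hI k hk).2.2.1.symm⟩, rfl⟩
  have hq : ENNReal.ofReal φ * ENNReal.ofReal L ≤ ENNReal.ofReal y ^ 4 := by
    rw [← ENNReal.ofReal_mul hφ, ← ENNReal.ofReal_pow hy0]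
    exact ENNReal.ofReal_le_ofReal hL
  have hfinal : (ENNReal.ofReal φ * ENNReal.ofReal L) ^ I.card ≤ ENNReal.ofReal y ^ s := by
    refine (pow_le_pow_left' hq _).trans ?_
    rw [← pow_mul]
    exact pow_le_pow_right_of_le_one' (by simpa using hy1) hcard
  -- With no form there may be no edge to serve as a default pivot.
  rcases I.eq_empty_or_nonempty with rfl | ⟨k₀, hk₀⟩
  · exact prob_le_one.trans (by simpa using hfinal)
  have : Nonempty (⊤ : SimpleGraph (Fin n)).edgeSet := ⟨(hex k₀ hk₀).choose⟩
  choose! p hp using hex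
  let β : ℕ × ℕ → (⊤ : SimpleGraph (Fin n)).edgeSet → ℝ := fun k => pairForm σ w k.1 k.2
  have h1 : ∀ k ∈ I, 1 ≤ |β k (p k)| := fun k hk =>
    one_le_abs_pairForm (hI k hk).2.1 (hp k hk) (hI k hk).2.2.2
  have h2 : ∀ k ∈ I, ∀ l ∈ I, k ≠ l → ord l ≤ ord k → β l (p k) = 0 := by
    intro k hk l hl hkl hord
    by_cases hv : w l.1 ∈ (p k : Sym2 (Fin n))
    · obtain ⟨v, hv⟩ := hv
      exact pairForm_eq_zero_of_not_odd (hI l hl).2.1 hv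
        (htri k hk l hl hkl hord v (by rw [← hv, hp k hk]))
    · exact pairForm_eq_zero hv
  refine le_trans (measure_mono fun ω hω => ?_) ((hX.triangular_le L β p ord I h1 h2).trans hfinal)
  exact fun k hk => hω k.1 k.2 (hI k hk).1 (hI k hk).2.1

theorem sum_Icc_pow_le {x : ℝ} (hx0 : 0 ≤ x) (hx : x ≤ 1 / 2) (n : ℕ) :
    ∑ s ∈ Finset.Icc 1 n, x ^ s ≤ 2 * x := by
  have h : ∀ n : ℕ, ∑ s ∈ Finset.Icc 1 n, x ^ s ≤ 2 * x - 2 * x * x ^ n := by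
    intro n
    induction n with
    | zero => simp
    | succ n ih =>
      rw [Finset.sum_Icc_succ_top (by omega)]
      have : 0 ≤ x ^ (n + 1) := pow_nonneg hx0 _
      have h2 : x * x ^ n = x ^ (n + 1) := (pow_succ' x n).symm
      nlinarith
  refine (h n).trans ?_
  have : 0 ≤ x * x ^ n := mul_nonneg hx0 (pow_nonneg hx0 _)
  linarith

/-- Union bound: `(2n)^(2s)` codes, each of probability at most `y ^ s`, give a geometric series of
ratio `4n²y`. -/
theorem IsSmoothedWeights.measure_exists_isCriticalWord_le [Nonempty (Fin n)]
    (hX : IsSmoothedWeights P X φ)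
    {L y : ℝ} (hy0 : 0 ≤ y) (hy1 : y ≤ 1) (hφ : 0 ≤ φ) (hL : φ * L ≤ y ^ 4)
    (hny : 4 * (n : ℝ) ^ 2 * y ≤ 1 / 2) :
    P {ω | ∃ s ∈ Finset.Icc 1 n, ∃ f : Fin (2 * s) → Fin n × ℤˣ,
      IsCriticalWord (codeWord f) s ∧ ∀ i j, j < 2 * s → Successive (codeWord f) i j →
        ∑ e, pairForm (G := ⊤) (codeConfig f) (codeWord f) i j e * X e ω ∈ Set.Icc 0 L} ≤
      ENNReal.ofReal (8 * (n : ℝ) ^ 2 * y) := by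
  have hset : {ω | ∃ s ∈ Finset.Icc 1 n, ∃ f : Fin (2 * s) → Fin n × ℤˣ,
      IsCriticalWord (codeWord f) s ∧ ∀ i j, j < 2 * s → Successive (codeWord f) i j →
        ∑ e, pairForm (G := ⊤) (codeConfig f) (codeWord f) i j e * X e ω ∈ Set.Icc 0 L} =
      ⋃ s ∈ Finset.Icc 1 n, ⋃ f : Fin (2 * s) → Fin n × ℤˣ, {ω | IsCriticalWord (codeWord f) s ∧
        ∀ i j, j < 2 * s → Successive (codeWord f) i j →
          ∑ e, pairForm (G := ⊤) (codeConfig f) (codeWord f) i j e * X e ω ∈ Set.Icc 0 L} := by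
    ext ω
    simp only [Set.mem_ofPred_eq, Set.mem_iUnion, exists_prop]
  rw [hset]
  calc _ ≤ ∑ s ∈ Finset.Icc 1 n, ∑ _f : Fin (2 * s) → Fin n × ℤˣ, ENNReal.ofReal y ^ s := by
        refine (measure_biUnion_finset_le _ _).trans (Finset.sum_le_sum fun s _ => ?_)
        refine (measure_iUnion_fintype_le _ _).trans (Finset.sum_le_sum fun f _ => ?_)
        by_cases hf : IsCriticalWord (codeWord f) s
        · simp only [hf, true_and]
          exact hX.measure_isCriticalWord_le hf _ hy0 hy1 hφ hL
        · simp [hf]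
    _ = ENNReal.ofReal (∑ s ∈ Finset.Icc 1 n, (4 * (n : ℝ) ^ 2 * y) ^ s) := by
        rw [ENNReal.ofReal_sum_of_nonneg fun s _ => by positivity]
        refine Finset.sum_congr rfl fun s _ => ?_
        have h : (4 * (n : ℝ) ^ 2 * y) ^ s = (((n * 2) ^ (2 * s) : ℕ) : ℝ) * y ^ s := by
          push_cast
          rw [pow_mul, ← mul_pow]
          congr 1
          ring
        rw [Finset.sum_const, Finset.card_univ, Fintype.card_fun, Fintype.card_prod,
          Fintype.card_fin, Fintype.card_fin, Fintype.card_units_int, nsmul_eq_mul, h,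
          ENNReal.ofReal_mul (by positivity), ENNReal.ofReal_pow hy0, ENNReal.ofReal_natCast]
    _ ≤ ENNReal.ofReal (8 * (n : ℝ) ^ 2 * y) := by
        refine ENNReal.ofReal_le_ofReal ((sum_Icc_pow_le (by positivity) hny n).trans (le_of_eq ?_))
        ring

end UnionBound

/-! ### Long improving sequences -/

theorem abs_hamiltonian_le {n : ℕ} [Fintype (⊤ : SimpleGraph (Fin n)).edgeSet]
    {x : (⊤ : SimpleGraph (Fin n)).edgeSet → ℝ} (hx : ∀ e, |x e| ≤ 1) (σ : Config (Fin n)) :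
    |hamiltonian x σ| ≤ (n : ℝ) ^ 2 / 4 := by
  have hspin : ∀ e, |spinProd σ e| = 1 := by
    intro e
    induction e using Sym2.ind with
    | _ a b => rw [spinProd_mk, abs_mul, abs_spin, abs_spin, one_mul]
  have hcard : (Fintype.card (⊤ : SimpleGraph (Fin n)).edgeSet : ℝ) ≤ (n : ℝ) ^ 2 / 2 := by
    rw [← SimpleGraph.edgeFinset_card]
    have h : ((⊤ : SimpleGraph (Fin n)).edgeFinset.card : ℝ) ≤ (n.choose 2 : ℕ) := by
      have := (⊤ : SimpleGraph (Fin n)).card_edgeFinset_le_card_choose_two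
      rw [Fintype.card_fin] at this
      exact_mod_cast this
    rw [Nat.cast_choose_two] at h
    nlinarith [(Nat.cast_nonneg n : (0 : ℝ) ≤ n)]
  have hsum : |∑ e, x e * spinProd σ (e : Sym2 (Fin n))| ≤
      Fintype.card (⊤ : SimpleGraph (Fin n)).edgeSet := by
    refine (Finset.abs_sum_le_sum_abs _ _).trans ?_
    calc _ ≤ ∑ _e : (⊤ : SimpleGraph (Fin n)).edgeSet, (1 : ℝ) :=
          Finset.sum_le_sum fun e _ => by rw [abs_mul, hspin, mul_one]; exact hx e
      _ = _ := by simp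
  rw [hamiltonian, abs_mul, abs_neg, abs_of_nonneg (by norm_num : (0 : ℝ) ≤ 1 / 2)]
  linarith

/-- A long improving sequence contains `m` consecutive moves with a small total gain. -/
theorem IsImprovingSeq.exists_window {n : ℕ} (hn : 0 < n)
    [Fintype (⊤ : SimpleGraph (Fin n)).edgeSet]
    {x : (⊤ : SimpleGraph (Fin n)).edgeSet → ℝ} (hx : ∀ e, |x e| ≤ 1) {ℓ : ℕ}
    {σ : ℕ → Config (Fin n)} (h : IsImprovingSeq x ℓ σ) (m k : ℕ) (hk : m * k ≤ ℓ) {ε : ℝ}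
    (hε : (n : ℝ) ^ 2 ≤ k * ε) :
    ∃ τ, IsImprovingSeq x m τ ∧ hamiltonian x (τ m) - hamiltonian x (τ 0) ≤ ε := by
  by_contra hno
  push Not at hno
  -- If all `k` windows gained more than `ε`, then `H` would rise by at least `kε ≥ n²`, while its
  -- range has length at most `n² / 2`.
  have hstep : ∀ j ≤ k, j * ε ≤ hamiltonian x (σ (m * j)) - hamiltonian x (σ 0) := by
    intro j hj
    induction j with
    | zero => simp
    | succ j ih =>
      have hmj : m * j + m ≤ ℓ := by
        rw [← Nat.mul_succ]
        exact (Nat.mul_le_mul_left m hj).trans hk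
      have hwin := hno (fun t => σ (m * j + t)) fun t ht => h (m * j + t) (by omega)
      have := ih (by omega)
      simp only [add_zero] at hwin
      rw [Nat.mul_succ]
      push_cast
      linarith
  have h1 := hstep k le_rfl
  have h2 := abs_le.1 (abs_hamiltonian_le hx (σ (m * k)))
  have h3 := abs_le.1 (abs_hamiltonian_le hx (σ 0))
  have : (0 : ℝ) < (n : ℝ) ^ 2 := by positivity
  linarith

theorem IsSmoothedWeights.measureReal_exists_isImprovingSeq_le {n : ℕ} {Ω : Type*}
    [MeasurableSpace Ω] {P : Measure Ω} [IsProbabilityMeasure P]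
    {X : (⊤ : SimpleGraph (Fin n)).edgeSet → Ω → ℝ} {φ : ℝ} (hX : IsSmoothedWeights P X φ)
    {c η : ℝ} (hc : 0 < c) (hη : 0 < η) :
    P.real {ω | ∃ (ℓ : ℕ) (σ : ℕ → Config (Fin n)), c * φ ^ 5 * (n : ℝ) ^ (15 + η) ≤ (ℓ : ℝ) ∧
      IsImprovingSeq (fun e => X e ω) ℓ σ} ≤ 16 * (128 / c + 1) / (n + 1) := by
  -- Chosen so that `K⁴ c φ⁴ ≥ 8`, using `K ≥ 1`, `K c ≥ 128` and `φ ≥ 1 / 2`.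
  set K := 128 / c + 1 with hK
  have hK1 : 1 ≤ K := by rw [hK]; have : 0 < 128 / c := by positivity
                         linarith
  have hKc : 128 ≤ K * c := by
    rw [hK, add_mul, div_mul_cancel₀ _ hc.ne']
    linarith
  -- For small `n` the claimed bound is at least `1`.
  rcases le_or_gt ((n : ℝ) + 1) (16 * K) with hsmall | hlarge
  · exact measureReal_le_one.trans ((one_le_div (by positivity)).2 hsmall)
  set N := (n : ℝ) with hN
  have hNK : 15 * K < N := by linarith
  have hN1 : 1 ≤ N := by linarith
  have hn2 : 2 ≤ n := by
    have : (2 : ℝ) ≤ n := by linarith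
    exact_mod_cast this
  have : Nonempty (Fin n) := ⟨⟨0, by omega⟩⟩
  have hφ : 1 / 2 ≤ φ := hX.half_le ⟨s(⟨0, by omega⟩, ⟨1, by omega⟩), by simp⟩
  set T := c * φ ^ 5 * N ^ (15 + η) with hT
  have hφ4 : 1 / 16 ≤ φ ^ 4 := by
    have := pow_le_pow_left₀ (by norm_num) hφ 4
    norm_num at this ⊢
    exact this
  have hT15 : c * φ ^ 5 * N ^ 15 ≤ T := by
    refine mul_le_mul_of_nonneg_left ?_ (by positivity)
    rw [← Real.rpow_natCast]
    exact Real.rpow_le_rpow_of_exponent_le hN1 (by push_cast; linarith)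
  have hcN : 128 ≤ c * N := by nlinarith
  have hT0 : 4 * N ≤ T := by
    refine le_trans ?_ hT15
    have h1 : 1 / 32 ≤ φ ^ 5 := by
      rw [pow_succ]
      nlinarith
    have h2 : 1 ≤ N ^ 13 := one_le_pow₀ hN1
    calc 4 * N = (128 * N) * (1 / 32) := by ring
      _ ≤ ((c * N) * (N * N ^ 13)) * φ ^ 5 := by
        refine mul_le_mul ?_ h1 (by norm_num) (by positivity)
        refine mul_le_mul hcN ?_ (by positivity) (by positivity)
        exact le_mul_of_one_le_right (by positivity) h2
      _ = c * φ ^ 5 * N ^ 15 := by ring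
  have hTpos : 0 < T := by linarith
  -- At least `T / (4N)` windows share a total gain below `N²`; the choice of `y` then makes the
  -- union bound `8N²y = 8K / N`.
  set ε := 4 * N ^ 3 / T with hε
  set y := K / N ^ 3 with hy
  have hNpos : 0 < N := by linarith
  have hN3 : N ≤ N ^ 3 := le_self_pow₀ hN1 (by norm_num)
  have hy0 : 0 ≤ y := by positivity
  have hy1 : y ≤ 1 := (div_le_one (by positivity)).2 (by linarith)
  have hNy : N ^ 2 * y = K / N := by
    rw [hy]
    field_simp
  have hny : 4 * N ^ 2 * y ≤ 1 / 2 := by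
    rw [mul_assoc, hNy, mul_div_assoc', div_le_iff₀ hNpos]
    linarith
  have hL : φ * (2 * ε) ≤ y ^ 4 := by
    have h1 : 8 ≤ K ^ 4 * c * φ ^ 4 := by
      have : K ≤ K ^ 4 := le_self_pow₀ hK1 (by norm_num)
      have h2 : 128 ≤ K ^ 4 * c := hKc.trans (mul_le_mul_of_nonneg_right this hc.le)
      calc (8 : ℝ) = 128 * (1 / 16) := by norm_num
        _ ≤ _ := mul_le_mul h2 hφ4 (by norm_num) (by positivity)
    rw [hε, hy, div_pow, mul_div_assoc', mul_div_assoc', div_le_div_iff₀ hTpos (by positivity)]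
    calc φ * (2 * (4 * N ^ 3)) * (N ^ 3) ^ 4 = 8 * (φ * N ^ 15) := by ring
      _ ≤ (K ^ 4 * c * φ ^ 4) * (φ * N ^ 15) := mul_le_mul_of_nonneg_right h1 (by positivity)
      _ = K ^ 4 * (c * φ ^ 5 * N ^ 15) := by ring
      _ ≤ K ^ 4 * T := mul_le_mul_of_nonneg_left hT15 (by positivity)
  have hmain := hX.measure_exists_isCriticalWord_le hy0 hy1 (by linarith) hL hny
  have hle : P {ω | ∃ (ℓ : ℕ) (σ : ℕ → Config (Fin n)), T ≤ (ℓ : ℝ) ∧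
      IsImprovingSeq (fun e => X e ω) ℓ σ} ≤ ENNReal.ofReal (8 * N ^ 2 * y) := by
    refine le_trans (measure_mono_ae ?_) hmain
    filter_upwards [ae_all_iff.2 hX.abs_le_one] with ω hω
    rintro ⟨ℓ, σ, hℓ, hσ⟩
    -- Rounding down costs less than one window, which `T ≥ 4N` absorbs by halving `T / (2N)`.
    have hk : (T / (4 * N)) ≤ ((ℓ / (2 * n) : ℕ) : ℝ) := by
      have h1 : (ℓ : ℝ) < 2 * N * (((ℓ / (2 * n) : ℕ) : ℝ) + 1) := by
        rw [hN]
        exact_mod_cast Nat.lt_mul_div_succ ℓ (by omega : 0 < 2 * n)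
      rw [div_le_iff₀ (by positivity)]
      nlinarith
    have hkε : N ^ 2 ≤ ((ℓ / (2 * n) : ℕ) : ℝ) * ε := by
      calc N ^ 2 = T / (4 * N) * ε := by
            rw [hε]
            field_simp
        _ ≤ _ := mul_le_mul_of_nonneg_right hk (by positivity)
    obtain ⟨τ, hτ, hτε⟩ := hσ.exists_window (by omega) hω (2 * n) (ℓ / (2 * n))
      (Nat.mul_div_le _ _) hkε
    exact hτ.exists_isCriticalWord hτε
  refine (ENNReal.toReal_mono ENNReal.ofReal_ne_top hle).trans ?_
  rw [ENNReal.toReal_ofReal (by positivity), mul_assoc, hNy, mul_div_assoc', div_le_div_iff₀ hNpos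
    (by positivity)]
  nlinarith

/-! ### Implementations -/

/-- An implementation that does not terminate within `T` steps runs through an improving sequence
of length at least `T`. -/
theorem Implementation.exists_isImprovingSeq {V : Type*} [Fintype V] {G : SimpleGraph V}
    [Fintype G.edgeSet] (I : Implementation G) {w : G.edgeSet → ℝ} {T : ℝ} (hT : 0 ≤ T)
    (h : ¬ I.TerminatesWithin w T) :
    ∃ (ℓ : ℕ) (σ : ℕ → Config V), T ≤ (ℓ : ℝ) ∧ IsImprovingSeq w ℓ σ := by
  -- None of the configurations at times `0, …, ⌊T⌋` is a local maximum, so there are `⌊T⌋ + 1`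
  -- moves.
  refine ⟨⌊T⌋₊ + 1, fun t => (I.run w t).2, ?_, fun t ht => ?_⟩
  · push_cast
    exact (Nat.lt_floor_add_one T).le
  · have hmax : ¬ IsLocalMaxCut w (I.run w t).2 := fun hloc =>
      h ⟨t, (Nat.le_floor_iff hT).1 (by omega), hloc⟩
    have : (I.run w (t + 1)).2 = I.next w (I.run w t).1 (I.run w t).2 := by
      simp only [Implementation.run, if_neg hmax]
    simp only [this]
    exact I.improving w _ _ hmax

end LocalMaxCut
end

theorem theorem1 (η : ℝ) (hη : 0 < η) :
    (∃ C : ℝ, 0 < C ∧ ∃ r : ℕ → ℝ, Tendsto r atTop (𝓝 0) ∧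
      ∀ (n : ℕ) (Ω : Type*) [MeasurableSpace Ω] (P : Measure Ω) [IsProbabilityMeasure P]
        (X : (⊤ : SimpleGraph (Fin n)).edgeSet → Ω → ℝ) (φ : ℝ),
        LocalMaxCut.IsSmoothedWeights P X φ →
        1 - r n ≤ P.real {ω | ∀ I : LocalMaxCut.Implementation (⊤ : SimpleGraph (Fin n)),
          I.TerminatesWithin (fun e => X e ω) (C * φ ^ 5 * (n : ℝ) ^ (15 + η))}) ∧
    (∀ c : ℝ, 0 < c → ∃ r : ℕ → ℝ, Tendsto r atTop (𝓝 0) ∧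
      ∀ (n : ℕ) (Ω : Type*) [MeasurableSpace Ω] (P : Measure Ω) [IsProbabilityMeasure P]
        (X : (⊤ : SimpleGraph (Fin n)).edgeSet → Ω → ℝ) (φ : ℝ),
        LocalMaxCut.IsSmoothedWeights P X φ →
        P.real {ω | ∃ (ℓ : ℕ) (σ : ℕ → LocalMaxCut.Config (Fin n)),
          c * φ ^ 5 * (n : ℝ) ^ (15 + η) ≤ (ℓ : ℝ) ∧
          LocalMaxCut.IsImprovingSeq (fun e => X e ω) ℓ σ} ≤ r n) := by
  have hr : ∀ c : ℝ, Tendsto (fun n : ℕ => 16 * (128 / c + 1) / ((n : ℝ) + 1)) atTop (𝓝 0) :=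
    fun c => tendsto_const_nhds.div_atTop
      (tendsto_atTop_add_const_right _ 1 tendsto_natCast_atTop_atTop)
  refine ⟨⟨1, one_pos, _, hr 1, fun n Ω _ P _ X φ hX => ?_⟩,
    fun c hc => ⟨_, hr c, fun n Ω _ P _ X φ hX =>
      hX.measureReal_exists_isImprovingSeq_le hc hη⟩⟩
  -- For `n ≤ 1` there is no edge, hence no lower bound on `φ`, but the error term exceeds `1`.
  rcases le_or_gt n 1 with hn | hn
  · have h1 : (1 : ℝ) ≤ 16 * (128 / 1 + 1) / ((n : ℝ) + 1) := by
      rw [le_div_iff₀ (by positivity)]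
      have : (n : ℝ) ≤ 1 := by exact_mod_cast hn
      linarith
    exact (sub_nonpos.2 h1).trans measureReal_nonneg
  have hφ : 1 / 2 ≤ φ := hX.half_le ⟨s(⟨0, by omega⟩, ⟨1, by omega⟩), by simp⟩
  have hbad := hX.measureReal_exists_isImprovingSeq_le one_pos hη
  set A := {ω | ∀ I : LocalMaxCut.Implementation (⊤ : SimpleGraph (Fin n)),
    I.TerminatesWithin (fun e => X e ω) (1 * φ ^ 5 * (n : ℝ) ^ (15 + η))}
  set B := {ω | ∃ (ℓ : ℕ) (σ : ℕ → LocalMaxCut.Config (Fin n)),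
    1 * φ ^ 5 * (n : ℝ) ^ (15 + η) ≤ (ℓ : ℝ) ∧
    LocalMaxCut.IsImprovingSeq (fun e => X e ω) ℓ σ}
  -- A cover and subadditivity avoid any measurability of `A`, which quantifies over all
  -- implementations.
  have hcover : (Set.univ : Set Ω) ⊆ A ∪ B := by
    intro ω _
    by_cases hω : ω ∈ A
    · exact Or.inl hω
    · right
      simp only [A, Set.mem_ofPred_eq, not_forall] at hω
      obtain ⟨I, hI⟩ := hω
      exact I.exists_isImprovingSeq (by positivity) hI
  have h1 : (1 : ℝ) ≤ P.real A + P.real B := by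
    rw [← probReal_univ (μ := P)]
    exact (measureReal_mono hcover).trans (measureReal_union_le A B)
  linarith
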